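/- **Setting.** Let $\mathcal Y$ be a set of outcomes and let $\ell(z;y)$, $z\in\mathbb R$, $y\in\mathcal Y$, be a negative log-likelihood (the likelihood is $p(y\mid z)=e^{-\ell(z;y)}$) such that $z\mapsto\ell(z;y)$ is $C^2$ with $\partial_z^2\ell(z;y)\le c$ for all $z,y$. For $k=1,\dots,K$ let expert $k$ be the Bayesian linear basis-expansion model with basis $\phi^{(k)}:\mathbb R^{d}\to\mathbb R^{F_k}$, $\|\phi^{(k)}(x)\|\le 1$ for all $x$, likelihood $p(y\mid x,\theta)=e^{-\ell(\phi^{(k)}(x)^\top\theta;\,y)}$ and prior $\theta\sim\mathcal N(0,\sigma_k^2 I_{F_k})$, $\sigma_k>0$. For a data stream $(x_t,y_t)_{t\ge1}$ write $\mathcal D_t=\{(x_s,y_s)\}_{s\le t}$ and let $r_{t,k}=p_k(y_t\mid x_t,\mathcal D_{t-1})$ be the posterior predictive density of expert $k$. Assume that up to the horizon $T$ the models are well defined on the data, that is, the marginal likelihoods $p_k(\mathcal D_t)$, $t\le T$, are finite. An ensemble predicting in round $t$ with weights $w_t$ in the probability simplex $\mathbb S^K$ has log-loss $-\log(w_t^\top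 r_t)$, and its regret against expert $k$ with fixed parameter $\theta_*\in\mathbb R^{F_k}$ is $$R_T(w;k,\theta_*)=\sum_{t=1}^T -\log(w_t^\top r_t)\;-\;\sum_{t=1}^T \ell\big(\phi^{(k)}(x_t)^\top\theta_*;\,y_t\big).$$ *O-BMA* with prior model probabilities $w_1\in\mathbb S^K$ uses $w_{t+1,k}=w_{t,k}r_{t,k}/\sum_j w_{t,j}r_{t,j}$. *Online Bayesian stacking (OBS) with the Online Newton Step (ONS)*, with parameters $\beta,\varepsilon>0$ and initial weights $w_1\in\mathbb S^K$, puts $\nabla_t=-r_t/(w_t^\top r_t)$, $A_0=\varepsilon I_K$, $A_t=A_{t-1}+\nabla_t\nabla_t^\top$ and $$w_{t+1}=\operatorname*{argmin}_{u\in\mathbb S^K}(u-v_t)^\top A_t(u-v_t),\qquad v_t=w_t-\tfrac1\beta A_t^{-1}\nabla_t .$$ **Theorem.** Fix $K$, $(F_k)$, $(\sigma_k)$, $c$, an expert $k$ and $\theta_*\in\mathbb R^{F_k}$. (a) For O-BMA with prior model probabilities $w_1$ such that $w_{1,k}>0$ (e.g. $w_1=(1/K,\dots,1/K)$), the regret against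 $(k,\theta_*)$ is $O(\log T)$: there is a constant $C$, depending only on the fixed quantities and $w_1$, such that $R_T(w;k,\theta_*)\le C\log T$ for all $d$, $\mathcal Y$, $\ell$, $\phi^{(1)},\dots,\phi^{(K)}$, all data streams and all $T\ge2$ as above. (b) Suppose in addition that the experts' log-losses are bounded: $|\log r_{t,j}|\le B$ for all $j$ and $t\le T$. Let $G=\sqrt K\,e^{2B}$, which bounds the gradient norms of $w\mapsto-\log(w^\top r_t)$ on $\mathbb S^K$, and let $D=\sqrt2$, which bounds the diameter of $\mathbb S^K$. Then for all ONS parameters $0<\beta\le\frac12\min\{\frac1{4GD},1\}$ and $\varepsilon>0$ and every $w_1\in\mathbb S^K$, the regret of OBS with ONS against $(k,\theta_*)$ is $O(\log T)$: there is a constant $C$, depending only on the fixed quantities and $w_1,B,\beta,\varepsilon$, such that $R_T(w;k,\theta_*)\le C\log T$ for all $d$, $\mathcal Y$, $\ell$, $\phi^{(1)},\dots,\phi^{(K)}$, all data streams and all $T\ge2$ as above. -/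

import Mathlib

open MeasureTheory ProbabilityTheory Matrix

noncomputable section

namespace BayesEnsemble

/-! ### Bayesian linear basis-expansion models

`ℓ z y` is the negative log-likelihood of the outcome `y` when the linear predictor is `z`, so the
likelihood is `exp (-ℓ z y)`.  Rounds are numbered `0, 1, 2, …`; in round `t` the input is `x t` and
the outcome is `y t`, and the data available before round `t` are `(x s, y s)` for `s < t`. -/

section Model

variable {n : ℕ} {X Y : Type*}

/-- The Gaussian prior `N(0, σ² I)` on the parameter space `ℝⁿ`. -/
def prior (n : ℕ) (σ : ℝ) : Measure (EuclideanSpace ℝ (Fin n)) :=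
  multivariateGaussian 0 (σ ^ 2 • (1 : Matrix (Fin n) (Fin n) ℝ))

/-- The loss `ℓ(φ(x_t)ᵀ θ; y_t)` in round `t` of the model with fixed parameter `θ`. -/
def paramLoss (ℓ : ℝ → Y → ℝ) (φ : X → EuclideanSpace ℝ (Fin n)) (x : ℕ → X) (y : ℕ → Y)
    (θ : EuclideanSpace ℝ (Fin n)) (t : ℕ) : ℝ :=
  ℓ (inner ℝ (φ (x t)) θ) (y t)

/-- The negative log-likelihood at `θ` of the first `t` data points. -/
def cumParamLoss (ℓ : ℝ → Y → ℝ) (φ : X → EuclideanSpace ℝ (Fin n)) (x : ℕ → X) (y : ℕ → Y)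
    (t : ℕ) (θ : EuclideanSpace ℝ (Fin n)) : ℝ :=
  ∑ s ∈ Finset.range t, paramLoss ℓ φ x y θ s

/-- The evidence (marginal likelihood) of the first `t` data points is finite, for every `t ≤ T`,
so that the posteriors and the predictive densities below are well defined. -/
def FiniteEvidence (σ : ℝ) (ℓ : ℝ → Y → ℝ) (φ : X → EuclideanSpace ℝ (Fin n)) (x : ℕ → X)
    (y : ℕ → Y) (T : ℕ) : Prop :=
  ∀ t ≤ T, Integrable (fun θ => Real.exp (-cumParamLoss ℓ φ x y t θ)) (prior n σ)

/-- The posterior given the first `t` data points: its density with respect to the prior is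
`exp (-cumParamLoss t θ) / ∫ exp (-cumParamLoss t)`. -/
def posterior (σ : ℝ) (ℓ : ℝ → Y → ℝ) (φ : X → EuclideanSpace ℝ (Fin n)) (x : ℕ → X)
    (y : ℕ → Y) (t : ℕ) : Measure (EuclideanSpace ℝ (Fin n)) :=
  (prior n σ).tilted (fun θ => -cumParamLoss ℓ φ x y t θ)

/-- The posterior predictive density `p(y_t | x_t, D)` of the outcome of round `t`, given the
data `D` of the earlier rounds. -/
def predictive (σ : ℝ) (ℓ : ℝ → Y → ℝ) (φ : X → EuclideanSpace ℝ (Fin n)) (x : ℕ → X)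
    (y : ℕ → Y) (t : ℕ) : ℝ :=
  ∫ θ, Real.exp (-paramLoss ℓ φ x y θ t) ∂(posterior σ ℓ φ x y t)

end Model

/-! ### Ensembles

`r t k` is the predictive density that expert `k` assigned to the outcome of round `t`, and `w t`
is the weight vector with which the ensemble predicts in round `t`. -/

section Ensemble

variable {K : ℕ}

/-- The log-loss `-log ∑ k, w k * r k` of the mixture with weights `w`. -/
def mixLoss (w r : Fin K → ℝ) : ℝ := -Real.log (w ⬝ᵥ r)

/-- Online Bayesian model averaging with prior model probabilities `w₀`. -/
def bmaWeights (w₀ : Fin K → ℝ) (r : ℕ → Fin K → ℝ) : ℕ → Fin K → ℝ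
  | 0 => w₀
  | t + 1 => fun k => bmaWeights w₀ r t k * r t k / ∑ j, bmaWeights w₀ r t j * r t j

/-- The gradient `-r / (w ⬝ r)` of `mixLoss · r` at `w`. -/
def mixLossGrad (w r : Fin K → ℝ) : Fin K → ℝ := -((w ⬝ᵥ r)⁻¹ • r)

/-- `u` minimizes `(u - v)ᵀ A (u - v)` over the probability simplex. -/
def IsSimplexProj (A : Matrix (Fin K) (Fin K) ℝ) (v u : Fin K → ℝ) : Prop :=
  u ∈ stdSimplex ℝ (Fin K) ∧
    IsMinOn (fun u : Fin K → ℝ => (u - v) ⬝ᵥ (A *ᵥ (u - v))) (stdSimplex ℝ (Fin K)) u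

theorem exists_isSimplexProj [NeZero K] (A : Matrix (Fin K) (Fin K) ℝ) (v : Fin K → ℝ) :
    ∃ u, IsSimplexProj A v u := by
  obtain ⟨u, hu, hmin⟩ := (isCompact_stdSimplex ℝ (Fin K)).exists_isMinOn
    ⟨_, single_mem_stdSimplex ℝ (0 : Fin K)⟩
    (f := fun u : Fin K → ℝ => (u - v) ⬝ᵥ (A *ᵥ (u - v))) (by fun_prop)
  exact ⟨u, hu, hmin⟩

/-- The projection of `v` onto the probability simplex in the norm given by `A`. -/
def simplexProj (A : Matrix (Fin K) (Fin K) ℝ) (v : Fin K → ℝ) : Fin K → ℝ :=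
  Classical.epsilon (IsSimplexProj A v)

theorem isSimplexProj_simplexProj [NeZero K] (A : Matrix (Fin K) (Fin K) ℝ) (v : Fin K → ℝ) :
    IsSimplexProj A v (simplexProj A v) :=
  Classical.epsilon_spec (exists_isSimplexProj A v)

/-- The state of the Online Newton Step on the simplex for the losses `mixLoss · (r t)`: the
matrix `ε I + ∑ s < t, ∇ₛ ∇ₛᵀ` and the weights for round `t`. The update is
`A' = A + ∇ ∇ᵀ`, `w' = proj_{A'} (w - (1/β) A'⁻¹ ∇)`. -/
def onsState (β ε : ℝ) (w₁ : Fin K → ℝ) (r : ℕ → Fin K → ℝ) :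
    ℕ → Matrix (Fin K) (Fin K) ℝ × (Fin K → ℝ)
  | 0 => (ε • (1 : Matrix (Fin K) (Fin K) ℝ), w₁)
  | t + 1 =>
    let A := (onsState β ε w₁ r t).1
    let w := (onsState β ε w₁ r t).2
    let g := mixLossGrad w (r t)
    let A' := A + vecMulVec g g
    (A', simplexProj A' (w - β⁻¹ • (A'⁻¹ *ᵥ g)))

/-- Online Bayesian stacking run with the Online Newton Step started at `w₁`. -/
def onsWeights (β ε : ℝ) (w₁ : Fin K → ℝ) (r : ℕ → Fin K → ℝ) (t : ℕ) : Fin K → ℝ :=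
  (onsState β ε w₁ r t).2

end Ensemble

/-- The regret after `T` rounds: the cumulative log-loss of the ensemble with weights `w` and expert
densities `r`, minus the cumulative loss `L` of the comparator. -/
def regret {K : ℕ} (w r : ℕ → Fin K → ℝ) (L : ℕ → ℝ) (T : ℕ) : ℝ :=
  ∑ t ∈ Finset.range T, mixLoss (w t) (r t) - ∑ t ∈ Finset.range T, L t

/-- The densities that the experts of an ensemble of basis expansions assign to the outcomes. -/
def expertDensities {K : ℕ} {X Y : Type*} {F : Fin K → ℕ} (σ : Fin K → ℝ) (ℓ : ℝ → Y → ℝ)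
    (φ : (k : Fin K) → X → EuclideanSpace ℝ (Fin (F k))) (x : ℕ → X) (y : ℕ → Y)
    (t : ℕ) (k : Fin K) : ℝ :=
  predictive (σ k) ℓ (φ k) x y t

/-- Standing assumptions on an ensemble and its data up to round `T`: the negative log-likelihood
is `C²` in the linear predictor with second derivative at most `c`, the features have norm at most
`1`, and every expert has finite evidence. -/
structure Admissible {K : ℕ} {X Y : Type*} {F : Fin K → ℕ} (σ : Fin K → ℝ) (c : ℝ)
    (ℓ : ℝ → Y → ℝ) (φ : (k : Fin K) → X → EuclideanSpace ℝ (Fin (F k)))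
    (x : ℕ → X) (y : ℕ → Y) (T : ℕ) : Prop where
  contDiff : ∀ y', ContDiff ℝ 2 (fun z => ℓ z y')
  second_deriv_le : ∀ y' z, iteratedDeriv 2 (fun z => ℓ z y') z ≤ c
  norm_feature_le : ∀ k x', ‖φ k x'‖ ≤ 1
  finite_evidence : ∀ k, FiniteEvidence (σ k) ℓ (φ k) x y T

end BayesEnsemble

end

namespace BayesEnsemble

/-! ### One-dimensional inequalities -/

/-! The regret splits into the ensemble's excess over expert `k` plus the expert's excess over the
fixed parameter.

The expert's predictive densities are ratios of consecutive evidences, so its cumulative log-loss is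
minus the log evidence (`sum_neg_log_predictive`). The curvature bound puts the cumulative loss
below a quadratic centred at the comparator, with Hessian at most `max c 0 * T` times the identity.
Integrating this against the Gaussian prior costs a constant plus `n / 2 * log (1 + max c 0 * σ ^ 2
* T)` (`neg_log_evidence_le`).

For model averaging, the ensemble's excess is at most `-log (w₀ k)`, because the final weight of `k`
is at most one. For the Newton step, exp-concavity of the log-loss (`mixLoss_sub_le`) supplies a
negative quadratic term that pays for the growth of the matrix in `newtonStep_le`. What remains
telescopes to a log-determinant, which is at most `K * log T` plus a constant since the trace grows
linearly. -/

theorem le_quadratic_of_deriv2_le {f : ℝ → ℝ} {c : ℝ} (hf : ContDiff ℝ 2 f)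
    (hc : ∀ z, iteratedDeriv 2 f z ≤ c) (z z₀ : ℝ) :
    f z ≤ f z₀ + deriv f z₀ * (z - z₀) + c / 2 * (z - z₀) ^ 2 := by
  have hd : Differentiable ℝ f := hf.differentiable (by norm_num)
  have hd' : Differentiable ℝ (deriv f) := hf.differentiable_deriv_two
  have h1 : ∀ x, HasDerivAt (fun x => c / 2 * x ^ 2 - f x) (c * x - deriv f x) x := fun x => by
    refine (((hasDerivAt_pow 2 x).const_mul (c / 2)).sub (hd x).hasDerivAt).congr_deriv ?_
    norm_num; ring
  have h1' : deriv (fun x => c / 2 * x ^ 2 - f x) = fun x => c * x - deriv f x :=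
    funext fun x => (h1 x).deriv
  have h2 : ∀ x, HasDerivAt (fun x => c * x - deriv f x) (c - deriv (deriv f) x) x := fun x => by
    refine (((hasDerivAt_id x).const_mul c).sub (hd' x).hasDerivAt).congr_deriv ?_
    rw [mul_one]
  -- This function is convex, so it lies above its tangent at `z₀`; that is the claim.
  have hconv : ConvexOn ℝ Set.univ (fun x => c / 2 * x ^ 2 - f x) := by
    refine convexOn_univ_of_deriv2_nonneg (fun x => (h1 x).differentiableAt) ?_ fun x => ?_
    · rw [h1']; exact fun x => (h2 x).differentiableAt
    · have := hc x
      rw [iteratedDeriv_eq_iterate] at this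
      simp only [Function.iterate_succ, Function.iterate_zero, Function.comp, id] at this ⊢
      rw [h1', (h2 x).deriv]
      linarith
  have key : (c * z₀ - deriv f z₀) * (z - z₀) ≤ (c / 2 * z ^ 2 - f z) - (c / 2 * z₀ ^ 2 - f z₀) := by
    rcases lt_trichotomy z z₀ with h | rfl | h
    · have := hconv.slope_le_of_hasDerivAt trivial trivial h (h1 z₀)
      rw [slope_def_field, div_le_iff₀ (by linarith)] at this
      linarith
    · simp
    · have := hconv.le_slope_of_hasDerivAt trivial trivial h (h1 z₀)
      rwa [slope_def_field, le_div_iff₀ (by linarith)] at this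
  nlinarith

/-- Exp-concavity of the logarithmic loss, in one variable. -/
theorem log_one_add_le_sub_sq {β s : ℝ} (hs : -1 < s) (hβ : β ≤ 1 / 2) (hβs : β * (1 + s) ≤ 1) :
    Real.log (1 + s) ≤ s - β / 2 * s ^ 2 := by
  have hx : 0 < 1 + s := by linarith
  rcases le_total s 0 with h | h
  -- With `y = √(1 + s)`, the bound `log y ≤ y - 1` leaves a polynomial inequality whose worst case
  -- is `β = 1 / 2`; there it reads `(y - 1)² (4 - (y + 1)²) ≥ 0`.
  · have hy : 0 < √(1 + s) := Real.sqrt_pos.2 hx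
    have hy2 : √(1 + s) ^ 2 = 1 + s := Real.sq_sqrt hx.le
    have hy1 : √(1 + s) ≤ 1 := Real.sqrt_le_one.2 (by linarith)
    have hlog := Real.log_le_sub_one_of_pos hy
    rw [Real.log_sqrt hx.le] at hlog
    generalize √(1 + s) = y at *
    obtain rfl : s = y ^ 2 - 1 := by linarith
    nlinarith [mul_nonneg (sq_nonneg (y - 1)) (show 0 ≤ 4 - (y + 1) ^ 2 by nlinarith),
      mul_nonneg (sq_nonneg (y ^ 2 - 1)) (sub_nonneg.2 hβ)]
  -- With `X = 1 + s`, `log X ≤ sinh (log X) = (X - 1 / X) / 2`, which equals `s - s² / (2 X)`, and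
  -- `β ≤ 1 / X`.
  · have h1 := Real.self_le_sinh_iff.2 (Real.log_nonneg (by linarith : 1 ≤ 1 + s))
    rw [Real.sinh_eq, Real.exp_neg, Real.exp_log hx] at h1
    have h2 : β ≤ (1 + s)⁻¹ := by rwa [← one_div, le_div_iff₀ hx]
    have h3 : (1 + s - (1 + s)⁻¹) / 2 = s - (1 + s)⁻¹ / 2 * s ^ 2 := by field_simp; ring
    nlinarith [sq_nonneg s]

theorem exists_add_mul_log_le (a b : ℝ) :
    ∃ C : ℝ, ∀ T : ℕ, 2 ≤ T → a + b * Real.log T ≤ C * Real.log T := by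
  refine ⟨|a| / Real.log 2 + b, fun T hT => ?_⟩
  have h2 : 0 < Real.log 2 := Real.log_pos (by norm_num)
  have h : Real.log 2 ≤ Real.log T := Real.log_le_log (by norm_num) (by exact_mod_cast hT)
  have : |a| ≤ |a| / Real.log 2 * Real.log T := by
    rw [div_mul_eq_mul_div, le_div_iff₀ h2]
    exact mul_le_mul_of_nonneg_left h (abs_nonneg a)
  linarith [le_abs_self a]

theorem log_add_mul_le {a b : ℝ} (ha : 0 < a) (hb : 0 ≤ b) {T : ℕ} (hT : 1 ≤ T) :
    Real.log (a + b * T) ≤ Real.log (a + b) + Real.log T := by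
  have hT' : (1 : ℝ) ≤ T := by exact_mod_cast hT
  rw [← Real.log_mul (by positivity) (by positivity)]
  exact Real.log_le_log (by positivity) (by nlinarith)

/-! ### The Gaussian prior -/

/-- A scalar covariance makes the characteristic function a product; this reduces prior integrals to
one dimension. -/
theorem prior_eq_map_pi (n : ℕ) (σ : ℝ) :
    prior n σ = (Measure.pi fun _ : Fin n => gaussianReal 0 (σ ^ 2).toNNReal).map
      (WithLp.toLp 2) := by
  have hS : (σ ^ 2 • (1 : Matrix (Fin n) (Fin n) ℝ)).PosSemidef :=
    PosSemidef.one.smul (sq_nonneg σ)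
  rw [prior]
  apply Measure.ext_of_charFun
  ext t
  rw [charFun_multivariateGaussian hS, charFun_pi]
  simp_rw [charFun_gaussianReal, ← Complex.exp_sum]
  congr 1
  simp [smul_mulVec, dotProduct, Finset.sum_div, max_eq_left (sq_nonneg σ)]
  refine Finset.sum_congr rfl fun i _ => ?_
  ring

theorem integral_prior_prod {n : ℕ} (σ : ℝ) (f : Fin n → ℝ → ℝ) :
    ∫ θ, ∏ i, f i (θ i) ∂(prior n σ) = ∏ i, ∫ x, f i x ∂(gaussianReal 0 (σ ^ 2).toNNReal) := by
  rw [prior_eq_map_pi, ← MeasurableEquiv.coe_toLp,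
    (MeasurableEquiv.toLp 2 (Fin n → ℝ)).measurableEmbedding.integral_map]
  exact integral_fintype_prod_eq_prod f

/-- Complete the square. The exact value carries a further factor `exp (s ^ 2 / (4 * p)) ≥ 1`;
dropping it removes the slope `a` from the bound. -/
theorem le_integral_exp_neg_quadratic_gaussianReal {σ : ℝ} (hσ : 0 < σ) {b : ℝ} (hb : 0 ≤ b)
    (a m : ℝ) :
    Real.exp (-(m ^ 2 / (2 * σ ^ 2))) * √(1 / (1 + b * σ ^ 2)) ≤
      ∫ x, Real.exp (-(a * (x - m) + b / 2 * (x - m) ^ 2))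
        ∂(gaussianReal 0 (σ ^ 2).toNNReal) := by
  have hv : 0 < σ ^ 2 := by positivity
  have hv0 : (σ ^ 2).toNNReal ≠ 0 := by simpa using hσ.ne'
  rw [integral_gaussianReal_eq_integral_smul hv0]
  simp only [gaussianPDFReal, Real.coe_toNNReal _ hv.le, sub_zero, smul_eq_mul]
  generalize σ ^ 2 = v at hv
  set p := (1 / v + b) / 2 with hp
  have hp0 : 0 < p := by positivity
  set s := m / v + a with hs
  have hcongr : ∀ x, (√(2 * Real.pi * v))⁻¹ * Real.exp (-x ^ 2 / (2 * v)) *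
      Real.exp (-(a * (x - m) + b / 2 * (x - m) ^ 2)) =
      (√(2 * Real.pi * v))⁻¹ * Real.exp (-(m ^ 2 / (2 * v)) + s ^ 2 / (4 * p)) *
        Real.exp (-p * (x - (m - s / (2 * p))) ^ 2) := fun x => by
    rw [mul_assoc _ (Real.exp _), mul_assoc _ (Real.exp _), ← Real.exp_add, ← Real.exp_add]
    congr 2
    have h1 : -(m ^ 2 / (2 * v)) + s ^ 2 / (4 * p) + -p * (x - (m - s / (2 * p))) ^ 2 =
        -(m ^ 2 / (2 * v)) - p * (x - m) ^ 2 - s * (x - m) := by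
      field_simp; ring
    rw [h1, hp, hs]
    field_simp; ring
  simp_rw [hcongr]
  rw [integral_const_mul, integral_sub_right_eq_self (fun x => Real.exp (-p * x ^ 2)),
    integral_gaussian]
  have h2 : √(1 / (1 + b * v)) = (√(2 * Real.pi * v))⁻¹ * √(Real.pi / p) := by
    rw [← Real.sqrt_inv, ← Real.sqrt_mul (by positivity)]
    congr 1
    rw [hp]
    have := Real.pi_pos
    field_simp
  rw [h2, mul_right_comm _ (Real.exp _), mul_comm (Real.exp _)]
  gcongr
  have : 0 ≤ s ^ 2 / (4 * p) := by positivity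
  linarith

theorem le_integral_exp_neg_quadratic_prior {n : ℕ} {σ : ℝ} (hσ : 0 < σ) {b : ℝ} (hb : 0 ≤ b)
    (a θ₀ : EuclideanSpace ℝ (Fin n)) :
    Real.exp (-(‖θ₀‖ ^ 2 / (2 * σ ^ 2))) * √(1 / (1 + b * σ ^ 2)) ^ n ≤
      ∫ θ, Real.exp (-(inner ℝ a (θ - θ₀) + b / 2 * ‖θ - θ₀‖ ^ 2)) ∂(prior n σ) := by
  have h : ∀ θ : EuclideanSpace ℝ (Fin n),
      Real.exp (-(inner ℝ a (θ - θ₀) + b / 2 * ‖θ - θ₀‖ ^ 2)) =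
      ∏ i, (fun x => Real.exp (-(a i * (x - θ₀ i) + b / 2 * (x - θ₀ i) ^ 2))) (θ i) := fun θ => by
    rw [← Real.exp_sum, EuclideanSpace.real_norm_sq_eq, PiLp.inner_apply]
    simp [Finset.sum_add_distrib, Finset.mul_sum, mul_comm]
  rw [funext h, integral_prior_prod σ fun i x =>
    Real.exp (-(a i * (x - θ₀ i) + b / 2 * (x - θ₀ i) ^ 2))]
  calc _ = ∏ i, Real.exp (-(θ₀ i ^ 2 / (2 * σ ^ 2))) * √(1 / (1 + b * σ ^ 2)) := by
        rw [Finset.prod_mul_distrib, ← Real.exp_sum, EuclideanSpace.real_norm_sq_eq]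
        simp [Finset.sum_div]
    _ ≤ _ := Finset.prod_le_prod (fun i _ => by positivity) fun i _ =>
        le_integral_exp_neg_quadratic_gaussianReal hσ hb _ _


/-! ### Cumulative predictive loss of a single expert -/

section Expert

variable {n : ℕ} {X Y : Type*} {σ c : ℝ} {ℓ : ℝ → Y → ℝ} {φ : X → EuclideanSpace ℝ (Fin n)}
  {x : ℕ → X} {y : ℕ → Y} {T : ℕ}

instance isProbabilityMeasure_prior (n : ℕ) (σ : ℝ) : IsProbabilityMeasure (prior n σ) := by
  unfold prior; infer_instance

theorem evidence_pos (hE : FiniteEvidence σ ℓ φ x y T) {t : ℕ} (ht : t ≤ T) :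
    0 < ∫ θ, Real.exp (-cumParamLoss ℓ φ x y t θ) ∂(prior n σ) :=
  integral_exp_pos (hE t ht)

theorem predictive_eq_div (σ : ℝ) (ℓ : ℝ → Y → ℝ) (φ : X → EuclideanSpace ℝ (Fin n)) (x : ℕ → X)
    (y : ℕ → Y) (t : ℕ) :
    predictive σ ℓ φ x y t = (∫ θ, Real.exp (-cumParamLoss ℓ φ x y (t + 1) θ) ∂(prior n σ)) /
      ∫ θ, Real.exp (-cumParamLoss ℓ φ x y t θ) ∂(prior n σ) := by
  rw [predictive, posterior, integral_exp_tilted]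
  simp only [Pi.add_apply, cumParamLoss, Finset.sum_range_succ, neg_add]

theorem predictive_pos (hE : FiniteEvidence σ ℓ φ x y T) {t : ℕ} (ht : t < T) :
    0 < predictive σ ℓ φ x y t := by
  rw [predictive_eq_div]
  exact div_pos (evidence_pos hE ht) (evidence_pos hE ht.le)

/-- The ratios of evidences telescope, and the evidence of no data is 1. -/
theorem sum_neg_log_predictive (hE : FiniteEvidence σ ℓ φ x y T) {t : ℕ} (ht : t ≤ T) :
    ∑ s ∈ Finset.range t, -Real.log (predictive σ ℓ φ x y s) =
      -Real.log (∫ θ, Real.exp (-cumParamLoss ℓ φ x y t θ) ∂(prior n σ)) := by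
  induction t with
  | zero => simp [cumParamLoss]
  | succ t ih =>
    rw [Finset.sum_range_succ, ih (by omega), predictive_eq_div,
      Real.log_div (evidence_pos hE ht).ne' (evidence_pos hE (by omega)).ne']
    ring

/-- Unit-norm features allow each rank-one Hessian bound to be replaced by a multiple of the
identity, so the Gaussian integral factorizes. This needs a nonnegative coefficient, hence `max c
0`. -/
theorem exists_cumParamLoss_le_quadratic (hℓ : ∀ y', ContDiff ℝ 2 fun z => ℓ z y')
    (hc : ∀ y' z, iteratedDeriv 2 (fun z => ℓ z y') z ≤ c) (hφ : ∀ x', ‖φ x'‖ ≤ 1)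
    (x : ℕ → X) (y : ℕ → Y) (T : ℕ) (θ₀ : EuclideanSpace ℝ (Fin n)) :
    ∃ a : EuclideanSpace ℝ (Fin n), ∀ θ, cumParamLoss ℓ φ x y T θ ≤ cumParamLoss ℓ φ x y T θ₀ +
      (inner ℝ a (θ - θ₀) + (max c 0 * T) / 2 * ‖θ - θ₀‖ ^ 2) := by
  refine ⟨∑ s ∈ Finset.range T,
    deriv (fun z => ℓ z (y s)) (inner ℝ (φ (x s)) θ₀) • φ (x s), fun θ => ?_⟩
  have hT : (max c 0 * T) / 2 * ‖θ - θ₀‖ ^ 2 =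
      ∑ _s ∈ Finset.range T, max c 0 / 2 * ‖θ - θ₀‖ ^ 2 := by
    rw [Finset.sum_const, Finset.card_range, nsmul_eq_mul]; ring
  rw [hT, sum_inner, cumParamLoss, cumParamLoss, ← Finset.sum_add_distrib,
    ← Finset.sum_add_distrib]
  refine Finset.sum_le_sum fun s _ => ?_
  have h := le_quadratic_of_deriv2_le (hℓ (y s)) (hc (y s)) (inner ℝ (φ (x s)) θ)
    (inner ℝ (φ (x s)) θ₀)
  rw [← inner_sub_right] at h
  rw [real_inner_smul_left, paramLoss, paramLoss]
  have hsq : (inner ℝ (φ (x s)) (θ - θ₀)) ^ 2 ≤ ‖θ - θ₀‖ ^ 2 := by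
    rw [sq_le_sq, abs_norm]
    exact (abs_real_inner_le_norm _ _).trans
      (mul_le_of_le_one_left (norm_nonneg _) (hφ (x s)))
  have h2 : c / 2 * (inner ℝ (φ (x s)) (θ - θ₀)) ^ 2 ≤ max c 0 / 2 * ‖θ - θ₀‖ ^ 2 :=
    mul_le_mul (by linarith [le_max_left c 0]) hsq (sq_nonneg _)
      (by linarith [le_max_right c 0])
  linarith

theorem neg_log_evidence_le (hσ : 0 < σ) (hℓ : ∀ y', ContDiff ℝ 2 fun z => ℓ z y')
    (hc : ∀ y' z, iteratedDeriv 2 (fun z => ℓ z y') z ≤ c) (hφ : ∀ x', ‖φ x'‖ ≤ 1)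
    (hE : FiniteEvidence σ ℓ φ x y T) (θ₀ : EuclideanSpace ℝ (Fin n)) :
    -Real.log (∫ θ, Real.exp (-cumParamLoss ℓ φ x y T θ) ∂(prior n σ)) ≤
      cumParamLoss ℓ φ x y T θ₀ + ‖θ₀‖ ^ 2 / (2 * σ ^ 2) +
        n / 2 * Real.log (1 + max c 0 * σ ^ 2 * T) := by
  obtain ⟨a, ha⟩ := exists_cumParamLoss_le_quadratic hℓ hc hφ x y T θ₀
  have hb : 0 ≤ max c 0 * T := by positivity
  have hpos : 0 < 1 + max c 0 * T * σ ^ 2 := by positivity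
  have key : Real.exp (-cumParamLoss ℓ φ x y T θ₀) *
      (Real.exp (-(‖θ₀‖ ^ 2 / (2 * σ ^ 2))) * √(1 / (1 + max c 0 * T * σ ^ 2)) ^ n) ≤
      ∫ θ, Real.exp (-cumParamLoss ℓ φ x y T θ) ∂(prior n σ) := by
    refine (mul_le_mul_of_nonneg_left (le_integral_exp_neg_quadratic_prior hσ hb a θ₀)
      (Real.exp_nonneg _)).trans ?_
    rw [← integral_const_mul]
    -- Finite evidence is used here: without integrability the larger integral would default to 0.
    refine integral_mono_of_nonneg (.of_forall fun θ => by positivity) (hE T le_rfl)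
      (.of_forall fun θ => ?_)
    simp only [← Real.exp_add]
    exact Real.exp_le_exp.2 (by linarith [ha θ])
  have hlog := Real.log_le_log (by positivity) key
  rw [Real.log_mul (by positivity) (by positivity), Real.log_mul (by positivity) (by positivity),
    Real.log_exp, Real.log_exp, Real.log_pow, Real.log_sqrt (by positivity), one_div,
    Real.log_inv, mul_right_comm] at hlog
  linarith

theorem sum_neg_log_predictive_sub_le (hσ : 0 < σ) (hℓ : ∀ y', ContDiff ℝ 2 fun z => ℓ z y')
    (hc : ∀ y' z, iteratedDeriv 2 (fun z => ℓ z y') z ≤ c) (hφ : ∀ x', ‖φ x'‖ ≤ 1)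
    (hE : FiniteEvidence σ ℓ φ x y T) (hT : 1 ≤ T) (θ₀ : EuclideanSpace ℝ (Fin n)) :
    ∑ t ∈ Finset.range T, -Real.log (predictive σ ℓ φ x y t) -
        ∑ t ∈ Finset.range T, paramLoss ℓ φ x y θ₀ t ≤
      ‖θ₀‖ ^ 2 / (2 * σ ^ 2) + n / 2 * Real.log (1 + max c 0 * σ ^ 2) +
        n / 2 * Real.log T := by
  have h1 := neg_log_evidence_le hσ hℓ hc hφ hE θ₀
  have h2 := mul_le_mul_of_nonneg_left
    (log_add_mul_le one_pos (show 0 ≤ max c 0 * σ ^ 2 by positivity) hT)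
    (show (0 : ℝ) ≤ n / 2 by positivity)
  rw [sum_neg_log_predictive hE le_rfl]
  change _ - cumParamLoss ℓ φ x y T θ₀ ≤ _
  linarith

end Expert

/-! ### Regret of Bayesian model averaging against an expert -/

section BMA

variable {K T : ℕ} {w₀ : Fin K → ℝ} {r : ℕ → Fin K → ℝ}

theorem dotProduct_pos_of_mem_stdSimplex {w v : Fin K → ℝ} (hw : w ∈ stdSimplex ℝ (Fin K))
    (hv : ∀ j, 0 < v j) : 0 < w ⬝ᵥ v := by
  refine (Finset.sum_nonneg fun j _ => mul_nonneg (hw.1 j) (hv j).le).lt_of_ne' fun h => ?_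
  have h0 := (Finset.sum_eq_zero_iff_of_nonneg
    fun j _ => mul_nonneg (hw.1 j) (hv j).le).1 h
  have h1 : ∑ j, w j = 0 := Finset.sum_eq_zero fun j hj =>
    (mul_eq_zero.1 (h0 j hj)).resolve_right (hv j).ne'
  exact one_ne_zero (hw.2.symm.trans h1)

theorem bmaWeights_mem_stdSimplex (hw₀ : w₀ ∈ stdSimplex ℝ (Fin K))
    (hr : ∀ t < T, ∀ j, 0 < r t j) {t : ℕ} (ht : t ≤ T) :
    bmaWeights w₀ r t ∈ stdSimplex ℝ (Fin K) := by
  induction t with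
  | zero => exact hw₀
  | succ t ih =>
    have ih := ih (by omega)
    have hpos : 0 < ∑ j, bmaWeights w₀ r t j * r t j :=
      dotProduct_pos_of_mem_stdSimplex ih (hr t (by omega))
    refine ⟨fun j => div_nonneg (mul_nonneg (ih.1 j) (hr t (by omega) j).le) hpos.le, ?_⟩
    simp only [bmaWeights]
    rw [← Finset.sum_div, div_self hpos.ne']

/-- The normalizer in the update is `exp (-mixLoss)`, so taking logs makes the recursion additive.
-/
theorem bmaWeights_pos_and_log_eq (hw₀ : w₀ ∈ stdSimplex ℝ (Fin K))
    (hr : ∀ t < T, ∀ j, 0 < r t j) {k : Fin K} (hk : 0 < w₀ k) {t : ℕ} (ht : t ≤ T) :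
    0 < bmaWeights w₀ r t k ∧
      Real.log (bmaWeights w₀ r t k) = Real.log (w₀ k) +
        ∑ s ∈ Finset.range t, (mixLoss (bmaWeights w₀ r s) (r s) + Real.log (r s k)) := by
  induction t with
  | zero => simpa [bmaWeights] using hk
  | succ t ih =>
    obtain ⟨ih1, ih2⟩ := ih (by omega)
    have hpos : 0 < bmaWeights w₀ r t ⬝ᵥ r t := dotProduct_pos_of_mem_stdSimplex
      (bmaWeights_mem_stdSimplex hw₀ hr (by omega)) (hr t (by omega))
    have hrk := hr t (by omega) k
    have he : bmaWeights w₀ r (t + 1) k =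
      bmaWeights w₀ r t k * r t k / (bmaWeights w₀ r t ⬝ᵥ r t) := rfl
    refine ⟨he ▸ by positivity, ?_⟩
    rw [he, Real.log_div (by positivity) hpos.ne', Real.log_mul ih1.ne' hrk.ne', ih2,
      Finset.sum_range_succ, mixLoss]
    ring

theorem sum_mixLoss_bmaWeights_le (hw₀ : w₀ ∈ stdSimplex ℝ (Fin K))
    (hr : ∀ t < T, ∀ j, 0 < r t j) {k : Fin K} (hk : 0 < w₀ k) :
    ∑ t ∈ Finset.range T, mixLoss (bmaWeights w₀ r t) (r t) ≤
      -Real.log (w₀ k) + ∑ t ∈ Finset.range T, -Real.log (r t k) := by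
  obtain ⟨hpos, hlog⟩ := bmaWeights_pos_and_log_eq hw₀ hr hk le_rfl
  have hmem := bmaWeights_mem_stdSimplex hw₀ hr le_rfl
  have hle : bmaWeights w₀ r T k ≤ 1 := hmem.2 ▸
    Finset.single_le_sum (fun j _ => hmem.1 j) (Finset.mem_univ k)
  have := Real.log_nonpos hpos.le hle
  rw [hlog, Finset.sum_add_distrib] at this
  rw [Finset.sum_neg_distrib]
  linarith

end BMA


/-! ### Projections and determinants for the Online Newton Step -/

section Matrix

variable {K : ℕ} {A : Matrix (Fin K) (Fin K) ℝ}

theorem dotProduct_mulVec_comm_of_isSymm (hA : A.IsSymm) (v w : Fin K → ℝ) :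
    v ⬝ᵥ (A *ᵥ w) = w ⬝ᵥ (A *ᵥ v) := by
  rw [dotProduct_mulVec, ← mulVec_transpose, hA.eq, dotProduct_comm]

theorem quadForm_add (hA : A.IsSymm) (v w : Fin K → ℝ) :
    (v + w) ⬝ᵥ (A *ᵥ (v + w)) = v ⬝ᵥ (A *ᵥ v) + 2 * (v ⬝ᵥ (A *ᵥ w)) + w ⬝ᵥ (A *ᵥ w) := by
  rw [mulVec_add, add_dotProduct, dotProduct_add, dotProduct_add,
    dotProduct_mulVec_comm_of_isSymm hA w v]
  ring

/-- Projection onto a convex set brings the point no farther from any member of the set, by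
first-order optimality along the segment from `u` to `z`. -/
theorem IsSimplexProj.quadForm_le (hA : A.PosSemidef) {v u z : Fin K → ℝ}
    (h : IsSimplexProj A v u) (hz : z ∈ stdSimplex ℝ (Fin K)) :
    (u - z) ⬝ᵥ (A *ᵥ (u - z)) ≤ (v - z) ⬝ᵥ (A *ᵥ (v - z)) := by
  have hs : A.IsSymm := by simpa using hA.isHermitian
  have hnn : ∀ x : Fin K → ℝ, 0 ≤ x ⬝ᵥ (A *ᵥ x) := fun x => by
    simpa using hA.dotProduct_mulVec_nonneg x
  have hq := hnn (z - u)
  have hb : 0 ≤ (u - v) ⬝ᵥ (A *ᵥ (z - u)) := by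
    by_contra! hneg
    set b := (u - v) ⬝ᵥ (A *ᵥ (z - u))
    set q := (z - u) ⬝ᵥ (A *ᵥ (z - u)) with hqdef
    -- A step short enough that `2 * l * b + l ^ 2 * q < 0`; the `+ 1` covers `q = 0`.
    set l := min 1 (-b / (q + 1))
    have hl0 : 0 < l := lt_min one_pos (div_pos (by linarith) (by linarith))
    have hl1 : l ≤ 1 := min_le_left _ _
    have hlq : l * (q + 1) ≤ -b := by
      rw [← le_div_iff₀ (by linarith)]; exact min_le_right _ _
    have hmem : u + l • (z - u) ∈ stdSimplex ℝ (Fin K) :=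
      (convex_stdSimplex ℝ (Fin K)).add_smul_sub_mem h.1 hz ⟨hl0.le, hl1⟩
    have hmin := h.2 hmem
    have he : u + l • (z - u) - v = (u - v) + l • (z - u) := by abel
    simp only [Set.mem_ofPred_eq, he, quadForm_add hs (u - v), mulVec_smul, dotProduct_smul,
      smul_dotProduct, smul_eq_mul] at hmin
    change _ ≤ _ + 2 * (l * b) + l * (l * q) at hmin
    nlinarith
  have e1 : v - z = (u - z) + -(u - v) := by abel
  have e2 : z - u = -(u - z) := by abel
  rw [e2, mulVec_neg, dotProduct_neg, dotProduct_mulVec_comm_of_isSymm hs] at hb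
  rw [e1, quadForm_add hs, mulVec_neg, dotProduct_neg, neg_dotProduct_neg]
  linarith [hnn (u - v)]

theorem quadForm_add_vecMulVec (A : Matrix (Fin K) (Fin K) ℝ) (g v : Fin K → ℝ) :
    v ⬝ᵥ ((A + vecMulVec g g) *ᵥ v) = v ⬝ᵥ (A *ᵥ v) + (g ⬝ᵥ v) ^ 2 := by
  rw [add_mulVec, dotProduct_add, vecMulVec_mulVec]
  simp [dotProduct_smul, dotProduct_comm v g]
  ring

theorem posDef_add_vecMulVec (hA : A.PosDef) (g : Fin K → ℝ) : (A + vecMulVec g g).PosDef := by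
  have := posSemidef_vecMulVec_self_star g
  exact hA.add_posSemidef (by simpa using this)

/-- The matrix determinant lemma for the downdate `A = A' - g gᵀ` gives `det A = det A' * (1 - gᵀ
A'⁻¹ g)`; then `log x ≤ x - 1`. -/
theorem dotProduct_inv_mulVec_le_log_det (hA : A.PosDef) (g : Fin K → ℝ) :
    g ⬝ᵥ ((A + vecMulVec g g)⁻¹ *ᵥ g) ≤
      Real.log (A + vecMulVec g g).det - Real.log A.det := by
  have hA' := posDef_add_vecMulVec hA g
  set A' := A + vecMulVec g g with hdef
  have hu : IsUnit A'.det := hA'.det_pos.ne'.isUnit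
  have hdet := det_add_replicateCol_mul_replicateRow (ι := Unit) hu (-g) g
  have e1 : A' + replicateCol Unit (-g) * replicateRow Unit g = A := by
    rw [← vecMulVec_eq, neg_vecMulVec, hdef]; abel
  have e2 : (1 + replicateRow Unit g * A'⁻¹ * replicateCol Unit (-g)).det =
      1 - g ⬝ᵥ (A'⁻¹ *ᵥ g) := by
    rw [det_unique, Matrix.mul_assoc, Matrix.add_apply, one_apply_eq, ← replicateCol_mulVec,
      replicateRow_mul_replicateCol_apply, mulVec_neg, dotProduct_neg, sub_eq_add_neg]
  rw [e1, e2] at hdet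
  have hpos : 0 < 1 - g ⬝ᵥ (A'⁻¹ *ᵥ g) := by
    have := hA.det_pos
    rw [hdet] at this
    exact pos_of_mul_pos_right this hA'.det_pos.le
  rw [hdet, Real.log_mul hA'.det_pos.ne' hpos.ne']
  linarith [Real.log_le_sub_one_of_pos hpos]

/-- Each eigenvalue is at most the trace. This is crude, but against AM-GM it loses only `K * log K`
in the logarithm. -/
theorem det_le_trace_pow (hA : A.PosSemidef) : A.det ≤ A.trace ^ K := by
  have h := hA.isHermitian
  have hnn := hA.eigenvalues_nonneg
  have ht : A.trace = ∑ i, h.eigenvalues i := by simpa using h.trace_eq_sum_eigenvalues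
  have hd : A.det = ∏ i, h.eigenvalues i := by simpa using h.det_eq_prod_eigenvalues
  rw [ht, hd]
  calc _ ≤ ∏ _i : Fin K, ∑ j, h.eigenvalues j :=
        Finset.prod_le_prod (fun i _ => hnn i) fun i _ =>
          Finset.single_le_sum (fun j _ => hnn j) (Finset.mem_univ i)
    _ = _ := by simp

/-- One Online Newton Step. -/
theorem newtonStep_le (hA : A.PosDef) {β : ℝ} (hβ : 0 < β) (g w u w' : Fin K → ℝ)
    (hu : u ∈ stdSimplex ℝ (Fin K))
    (hw' : IsSimplexProj (A + vecMulVec g g)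
      (w - β⁻¹ • ((A + vecMulVec g g)⁻¹ *ᵥ g)) w') :
    g ⬝ᵥ (w - u) - β / 2 * (g ⬝ᵥ (w - u)) ^ 2 ≤
      β / 2 * ((w - u) ⬝ᵥ (A *ᵥ (w - u)) -
        (w' - u) ⬝ᵥ ((A + vecMulVec g g) *ᵥ (w' - u))) +
      (2 * β)⁻¹ * (Real.log (A + vecMulVec g g).det - Real.log A.det) := by
  have hA' := posDef_add_vecMulVec hA g
  have hproj := hw'.quadForm_le hA'.posSemidef hu
  have hlog := dotProduct_inv_mulVec_le_log_det hA g
  have hq := quadForm_add_vecMulVec A g (w - u)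
  set A' := A + vecMulVec g g
  have hs : A'.IsSymm := by simpa using hA'.isHermitian
  set h := A'⁻¹ *ᵥ g
  have hAh : A' *ᵥ h = g := by
    rw [mulVec_mulVec, mul_nonsing_inv _ hA'.det_pos.ne'.isUnit, one_mulVec]
  have e : w - β⁻¹ • h - u = (w - u) + (-β⁻¹) • h := by rw [neg_smul]; abel
  rw [e, quadForm_add hs, mulVec_smul, hAh, dotProduct_smul, smul_dotProduct, dotProduct_smul, hq,
    dotProduct_comm (w - u) g, dotProduct_comm h g] at hproj
  simp only [smul_eq_mul] at hproj
  -- The factor `β / 2` turns the cross term of the expanded square into exactly `-(g ⬝ᵥ (w - u))`.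
  have hmul := mul_le_mul_of_nonneg_left hproj (show 0 ≤ β / 2 by positivity)
  have hmul' := mul_le_mul_of_nonneg_left hlog (show 0 ≤ (2 * β)⁻¹ by positivity)
  have e3 : β / 2 * ((w - u) ⬝ᵥ A *ᵥ (w - u) + (g ⬝ᵥ (w - u)) ^ 2 +
      2 * (-β⁻¹ * g ⬝ᵥ (w - u)) + -β⁻¹ * (-β⁻¹ * g ⬝ᵥ h)) =
      β / 2 * ((w - u) ⬝ᵥ A *ᵥ (w - u)) + β / 2 * (g ⬝ᵥ (w - u)) ^ 2 - g ⬝ᵥ (w - u) +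
        (2 * β)⁻¹ * g ⬝ᵥ h := by
    field_simp; ring
  rw [e3] at hmul
  linarith

end Matrix


/-! ### Regret of the Online Newton Step against an expert -/

section ONS

variable {K T : ℕ} {β ε B : ℝ} {w₁ : Fin K → ℝ} {r : ℕ → Fin K → ℝ}

theorem onsState_succ (β ε : ℝ) (w₁ : Fin K → ℝ) (r : ℕ → Fin K → ℝ) (t : ℕ) :
    onsState β ε w₁ r (t + 1) =
      ((onsState β ε w₁ r t).1 + vecMulVec (mixLossGrad (onsWeights β ε w₁ r t) (r t))
          (mixLossGrad (onsWeights β ε w₁ r t) (r t)),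
        simplexProj ((onsState β ε w₁ r t).1 +
            vecMulVec (mixLossGrad (onsWeights β ε w₁ r t) (r t))
              (mixLossGrad (onsWeights β ε w₁ r t) (r t)))
          (onsWeights β ε w₁ r t - β⁻¹ • (((onsState β ε w₁ r t).1 +
            vecMulVec (mixLossGrad (onsWeights β ε w₁ r t) (r t))
              (mixLossGrad (onsWeights β ε w₁ r t) (r t)))⁻¹ *ᵥ
              mixLossGrad (onsWeights β ε w₁ r t) (r t)))) :=
  rfl

theorem posDef_onsState (hε : 0 < ε) (t : ℕ) : (onsState β ε w₁ r t).1.PosDef := by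
  induction t with
  | zero => exact PosDef.one.smul hε
  | succ t ih => rw [onsState_succ]; exact posDef_add_vecMulVec ih _

theorem onsWeights_mem_stdSimplex [NeZero K] (hw₁ : w₁ ∈ stdSimplex ℝ (Fin K)) (t : ℕ) :
    onsWeights β ε w₁ r t ∈ stdSimplex ℝ (Fin K) := by
  cases t with
  | zero => exact hw₁
  | succ t => exact (isSimplexProj_simplexProj _ _).1

theorem exp_neg_le_dotProduct {w v : Fin K → ℝ} (hw : w ∈ stdSimplex ℝ (Fin K))
    (hv : ∀ j, Real.exp (-B) ≤ v j) : Real.exp (-B) ≤ w ⬝ᵥ v := by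
  calc Real.exp (-B) = ∑ j, w j * Real.exp (-B) := by rw [← Finset.sum_mul, hw.2, one_mul]
    _ ≤ _ := Finset.sum_le_sum fun j _ => mul_le_mul_of_nonneg_left (hv j) (hw.1 j)

theorem mixLossGrad_dotProduct_self_le {w v : Fin K → ℝ} (hw : w ∈ stdSimplex ℝ (Fin K))
    (hv : ∀ j, Real.exp (-B) ≤ v j) (hv' : ∀ j, v j ≤ Real.exp B) :
    mixLossGrad w v ⬝ᵥ mixLossGrad w v ≤ K * Real.exp (4 * B) := by
  have hd := exp_neg_le_dotProduct hw hv
  have hpos : 0 < w ⬝ᵥ v := (Real.exp_pos _).trans_le hd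
  have hinv : (w ⬝ᵥ v)⁻¹ ≤ Real.exp B := by
    rw [← neg_neg B, Real.exp_neg]; exact inv_anti₀ (Real.exp_pos _) hd
  have hj : ∀ j, mixLossGrad w v j * mixLossGrad w v j ≤ Real.exp (4 * B) := fun j => by
    have h0 : 0 ≤ v j := (Real.exp_pos _).le.trans (hv j)
    have h1 : (w ⬝ᵥ v)⁻¹ * v j ≤ Real.exp B * Real.exp B :=
      mul_le_mul hinv (hv' j) h0 (Real.exp_pos _).le
    have h2 := mul_self_le_mul_self (mul_nonneg (inv_nonneg.2 hpos.le) h0) h1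
    rw [← Real.exp_add, ← Real.exp_add] at h2
    simp only [mixLossGrad, Pi.neg_apply, Pi.smul_apply, smul_eq_mul, neg_mul_neg]
    rwa [show 4 * B = B + B + (B + B) by ring]
  simpa [dotProduct] using Finset.sum_le_card_nsmul Finset.univ _ _ fun j _ => hj j

/-- Against a vertex of the simplex, the linearized loss is `s = v k / (w ⬝ᵥ v) - 1` and the true
difference is `log (1 + s)`, so the one-variable inequality applies; the ratio is at most `exp (2 *
B)`. -/
theorem mixLoss_sub_le {w v : Fin K → ℝ} (hw : w ∈ stdSimplex ℝ (Fin K))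
    (hv : ∀ j, Real.exp (-B) ≤ v j) (hv' : ∀ j, v j ≤ Real.exp B) (hβ : 0 ≤ β)
    (hβ2 : β ≤ 1 / 2) (hβB : β * Real.exp (2 * B) ≤ 1) (k : Fin K) :
    mixLoss w v - -Real.log (v k) ≤
      mixLossGrad w v ⬝ᵥ (w - Pi.single k 1) -
        β / 2 * (mixLossGrad w v ⬝ᵥ (w - Pi.single k 1)) ^ 2 := by
  have hd := exp_neg_le_dotProduct hw hv
  have hpos : 0 < w ⬝ᵥ v := (Real.exp_pos _).trans_le hd
  have hk : 0 < v k := (Real.exp_pos _).trans_le (hv k)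
  have hs : mixLossGrad w v ⬝ᵥ (w - Pi.single k 1) = v k / (w ⬝ᵥ v) - 1 := by
    rw [mixLossGrad, neg_dotProduct, smul_dotProduct, dotProduct_sub, dotProduct_single,
      dotProduct_comm v w, smul_eq_mul]
    field_simp
    ring
  rw [hs]
  have h1 : 1 + (v k / (w ⬝ᵥ v) - 1) = v k / (w ⬝ᵥ v) := by ring
  have hle : v k / (w ⬝ᵥ v) ≤ Real.exp (2 * B) := by
    rw [div_le_iff₀ hpos]
    calc v k ≤ Real.exp B := hv' k
      _ = Real.exp (2 * B) * Real.exp (-B) := by rw [← Real.exp_add]; ring_nf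
      _ ≤ _ := mul_le_mul_of_nonneg_left hd (Real.exp_pos _).le
  have h := log_one_add_le_sub_sq (β := β) (s := v k / (w ⬝ᵥ v) - 1)
    (by linarith [div_pos hk hpos]) hβ2
    (by rw [h1]; exact (mul_le_mul_of_nonneg_left hle hβ).trans hβB)
  rw [h1, Real.log_div hk.ne' hpos.ne'] at h
  rw [mixLoss]
  linarith

/-- The potentials are the squared distance to the vertex in the current matrix and the
log-determinant of that matrix. -/
theorem sum_mixLoss_onsWeights_sub_le [NeZero K] (hw₁ : w₁ ∈ stdSimplex ℝ (Fin K)) (hε : 0 < ε)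
    (hβ : 0 < β) (hβ2 : β ≤ 1 / 2) (hβB : β * Real.exp (2 * B) ≤ 1)
    (hr : ∀ t < T, ∀ j, Real.exp (-B) ≤ r t j) (hr' : ∀ t < T, ∀ j, r t j ≤ Real.exp B)
    (k : Fin K) {t : ℕ} (ht : t ≤ T) :
    ∑ s ∈ Finset.range t, (mixLoss (onsWeights β ε w₁ r s) (r s) - -Real.log (r s k)) ≤
      β / 2 * ((w₁ - Pi.single k 1) ⬝ᵥ ((onsState β ε w₁ r 0).1 *ᵥ (w₁ - Pi.single k 1)) -
        (onsWeights β ε w₁ r t - Pi.single k 1) ⬝ᵥ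
          ((onsState β ε w₁ r t).1 *ᵥ (onsWeights β ε w₁ r t - Pi.single k 1))) +
      (2 * β)⁻¹ * (Real.log (onsState β ε w₁ r t).1.det -
        Real.log (onsState β ε w₁ r 0).1.det) := by
  induction t with
  | zero => simp [onsWeights, onsState]
  | succ t ih =>
    have ih := ih (by omega)
    have h1 := mixLoss_sub_le (onsWeights_mem_stdSimplex (β := β) (ε := ε) (r := r) hw₁ t)
      (hr t (by omega)) (hr' t (by omega)) hβ.le hβ2 hβB k
    have h2 := newtonStep_le (posDef_onsState (β := β) (w₁ := w₁) (r := r) hε t) hβ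
      (mixLossGrad (onsWeights β ε w₁ r t) (r t)) (onsWeights β ε w₁ r t) (Pi.single k 1)
      (onsWeights β ε w₁ r (t + 1)) (single_mem_stdSimplex ℝ k) (isSimplexProj_simplexProj _ _)
    rw [Finset.sum_range_succ, show (onsState β ε w₁ r (t + 1)).1 = _ + _ from rfl]
    change _ ≤ _ * (_ - _ ⬝ᵥ (((onsState β ε w₁ r t).1 +
      vecMulVec (mixLossGrad (onsWeights β ε w₁ r t) (r t))
        (mixLossGrad (onsWeights β ε w₁ r t) (r t))) *ᵥ _)) +
      _ * (Real.log ((onsState β ε w₁ r t).1 +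
      vecMulVec (mixLossGrad (onsWeights β ε w₁ r t) (r t))
        (mixLossGrad (onsWeights β ε w₁ r t) (r t))).det - _)
    linarith

theorem trace_onsState_le [NeZero K] (hw₁ : w₁ ∈ stdSimplex ℝ (Fin K))
    (hr : ∀ t < T, ∀ j, Real.exp (-B) ≤ r t j) (hr' : ∀ t < T, ∀ j, r t j ≤ Real.exp B)
    {t : ℕ} (ht : t ≤ T) :
    (onsState β ε w₁ r t).1.trace ≤ K * ε + K * Real.exp (4 * B) * t := by
  induction t with
  | zero => simp [onsState, mul_comm]
  | succ t ih =>
    have ih := ih (by omega)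
    have h := mixLossGrad_dotProduct_self_le
      (onsWeights_mem_stdSimplex (β := β) (ε := ε) (r := r) hw₁ t) (hr t (by omega))
      (hr' t (by omega))
    rw [onsState_succ, trace_add, trace_vecMulVec]
    push_cast
    linarith

theorem sum_mixLoss_onsWeights_le [NeZero K] (hw₁ : w₁ ∈ stdSimplex ℝ (Fin K)) (hε : 0 < ε)
    (hβ : 0 < β) (hβ2 : β ≤ 1 / 2) (hβB : β * Real.exp (2 * B) ≤ 1)
    (hr : ∀ t < T, ∀ j, Real.exp (-B) ≤ r t j) (hr' : ∀ t < T, ∀ j, r t j ≤ Real.exp B)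
    (hT : 1 ≤ T) (k : Fin K) :
    ∑ t ∈ Finset.range T, mixLoss (onsWeights β ε w₁ r t) (r t) ≤
      β / 2 * (ε * ((w₁ - Pi.single k 1) ⬝ᵥ (w₁ - Pi.single k 1))) +
        (2 * β)⁻¹ * (K * Real.log (K * ε + K * Real.exp (4 * B)) - K * Real.log ε) +
        (2 * β)⁻¹ * K * Real.log T + ∑ t ∈ Finset.range T, -Real.log (r t k) := by
  have h := sum_mixLoss_onsWeights_sub_le hw₁ hε hβ hβ2 hβB hr hr' k le_rfl
  have hpd := posDef_onsState (β := β) (w₁ := w₁) (r := r) hε T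
  have hnn : 0 ≤ (onsWeights β ε w₁ r T - Pi.single k 1) ⬝ᵥ
      ((onsState β ε w₁ r T).1 *ᵥ (onsWeights β ε w₁ r T - Pi.single k 1)) := by
    simpa only [star_trivial] using hpd.posSemidef.dotProduct_mulVec_nonneg
      (onsWeights β ε w₁ r T - Pi.single k 1)
  have hK : (0 : ℝ) < K := by exact_mod_cast NeZero.pos K
  have hlog : Real.log (onsState β ε w₁ r T).1.det ≤
      K * Real.log (K * ε + K * Real.exp (4 * B)) + K * Real.log T := by
    have h1 := (det_le_trace_pow hpd.posSemidef).trans (pow_le_pow_left₀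
      hpd.posSemidef.trace_nonneg (trace_onsState_le (β := β) (ε := ε) hw₁ hr hr' le_rfl) K)
    have h2 := Real.log_le_log hpd.det_pos h1
    rw [Real.log_pow] at h2
    have h3 := mul_le_mul_of_nonneg_left (log_add_mul_le (show 0 < K * ε by positivity)
      (show 0 ≤ K * Real.exp (4 * B) by positivity) hT) hK.le
    linarith
  have h0 : (onsState β ε w₁ r 0).1 = ε • (1 : Matrix (Fin K) (Fin K) ℝ) := rfl
  have hdet0 : Real.log (onsState β ε w₁ r 0).1.det = K * Real.log ε := by
    rw [h0, det_smul, det_one, mul_one, Real.log_pow, Fintype.card_fin]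
  rw [hdet0, h0, smul_mulVec, one_mulVec, dotProduct_smul, smul_eq_mul,
    Finset.sum_sub_distrib] at h
  have hm := mul_le_mul_of_nonneg_left hlog (show 0 ≤ (2 * β)⁻¹ by positivity)
  have hm' := mul_nonneg (show 0 ≤ β / 2 by positivity) hnn
  linarith

end ONS


/-! ### Expert bounds for admissible ensembles -/

section Ensemble

variable {K : ℕ} {X Y : Type*} {F : Fin K → ℕ} {σ : Fin K → ℝ} {c : ℝ} {ℓ : ℝ → Y → ℝ}
  {φ : (k : Fin K) → X → EuclideanSpace ℝ (Fin (F k))} {x : ℕ → X} {y : ℕ → Y} {T : ℕ}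

theorem Admissible.expertDensities_pos (h : Admissible σ c ℓ φ x y T) {t : ℕ} (ht : t < T)
    (j : Fin K) : 0 < expertDensities σ ℓ φ x y t j :=
  predictive_pos (h.finite_evidence j) ht

theorem Admissible.sum_neg_log_expertDensities_sub_le (hσ : ∀ k, 0 < σ k)
    (h : Admissible σ c ℓ φ x y T) (hT : 1 ≤ T) (k : Fin K)
    (θ : EuclideanSpace ℝ (Fin (F k))) :
    ∑ t ∈ Finset.range T, -Real.log (expertDensities σ ℓ φ x y t k) -
        ∑ t ∈ Finset.range T, paramLoss ℓ (φ k) x y θ t ≤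
      ‖θ‖ ^ 2 / (2 * σ k ^ 2) + F k / 2 * Real.log (1 + max c 0 * σ k ^ 2) +
        F k / 2 * Real.log T :=
  sum_neg_log_predictive_sub_le (hσ k) h.contDiff h.second_deriv_le (h.norm_feature_le k)
    (h.finite_evidence k) hT θ

end Ensemble

/-- Only these two consequences of the step-size condition are needed; the factors `4`, `√K` and
`√2` are slack. -/
theorem newtonStepSize_bounds {K : ℕ} (hK : 1 ≤ K) {B β : ℝ} (hβ : 0 < β)
    (h : β ≤ 1 / 2 * min (1 / (4 * (√K * Real.exp (2 * B)) * √2)) 1) :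
    β ≤ 1 / 2 ∧ β * Real.exp (2 * B) ≤ 1 := by
  have h1 := min_le_left (1 / (4 * (√K * Real.exp (2 * B)) * √2)) 1
  have h2 := min_le_right (1 / (4 * (√K * Real.exp (2 * B)) * √2)) 1
  refine ⟨by linarith, ?_⟩
  have hK1 : 1 ≤ √(K : ℝ) := Real.one_le_sqrt.2 (by exact_mod_cast hK)
  have h21 : 1 ≤ √(2 : ℝ) := Real.one_le_sqrt.2 one_le_two
  have he := Real.exp_pos (2 * B)
  have hle : Real.exp (2 * B) ≤ 4 * (√K * Real.exp (2 * B)) * √2 := by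
    have h3 : Real.exp (2 * B) ≤ √K * Real.exp (2 * B) := le_mul_of_one_le_left he.le hK1
    have h4 : 4 * (√K * Real.exp (2 * B)) ≤ 4 * (√K * Real.exp (2 * B)) * √2 :=
      le_mul_of_one_le_right (by positivity) h21
    linarith
  have hβ' : β ≤ 1 / Real.exp (2 * B) := by
    have := one_div_le_one_div_of_le he hle
    have : 0 < 1 / (4 * (√K * Real.exp (2 * B)) * √2) := by positivity
    linarith
  rwa [le_div_iff₀ he] at hβ'

end BayesEnsemble

theorem mainTheorem1 {K : ℕ} (F : Fin K → ℕ) (σ : Fin K → ℝ) (hσ : ∀ k, 0 < σ k) (c : ℝ)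
    (k : Fin K) (θ : EuclideanSpace ℝ (Fin (F k))) :
    -- (a) online Bayesian model averaging
    (∀ w₀ ∈ stdSimplex ℝ (Fin K), 0 < w₀ k →
      ∃ C : ℝ, ∀ (d : ℕ) (Y : Type*) (ℓ : ℝ → Y → ℝ)
        (φ : (j : Fin K) → EuclideanSpace ℝ (Fin d) → EuclideanSpace ℝ (Fin (F j)))
        (x : ℕ → EuclideanSpace ℝ (Fin d)) (y : ℕ → Y) (T : ℕ), 2 ≤ T →
        BayesEnsemble.Admissible σ c ℓ φ x y T →
          BayesEnsemble.regret
            (BayesEnsemble.bmaWeights w₀ (BayesEnsemble.expertDensities σ ℓ φ x y))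
            (BayesEnsemble.expertDensities σ ℓ φ x y)
            (BayesEnsemble.paramLoss ℓ (φ k) x y θ) T ≤ C * Real.log T) ∧
    -- (b) online Bayesian stacking with the Online Newton Step, under bounded log-loss
    (∀ w₁ ∈ stdSimplex ℝ (Fin K), ∀ B β ε : ℝ, 0 < ε → 0 < β →
      β ≤ 1 / 2 * min (1 / (4 * (√K * Real.exp (2 * B)) * √2)) 1 →
      ∃ C : ℝ, ∀ (d : ℕ) (Y : Type*) (ℓ : ℝ → Y → ℝ)
        (φ : (j : Fin K) → EuclideanSpace ℝ (Fin d) → EuclideanSpace ℝ (Fin (F j)))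
        (x : ℕ → EuclideanSpace ℝ (Fin d)) (y : ℕ → Y) (T : ℕ), 2 ≤ T →
        BayesEnsemble.Admissible σ c ℓ φ x y T →
        (∀ t < T, ∀ j, |Real.log (BayesEnsemble.expertDensities σ ℓ φ x y t j)| ≤ B) →
          BayesEnsemble.regret
            (BayesEnsemble.onsWeights β ε w₁ (BayesEnsemble.expertDensities σ ℓ φ x y))
            (BayesEnsemble.expertDensities σ ℓ φ x y)
            (BayesEnsemble.paramLoss ℓ (φ k) x y θ) T ≤ C * Real.log T) := by
  have : NeZero K := NeZero.of_pos k.pos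
  refine ⟨fun w₀ hw₀ hk => ?_, fun w₁ hw₁ B β ε hε hβ hβle => ?_⟩
  · obtain ⟨C, hC⟩ := BayesEnsemble.exists_add_mul_log_le
      (-Real.log (w₀ k) + (‖θ‖ ^ 2 / (2 * σ k ^ 2) +
        F k / 2 * Real.log (1 + max c 0 * σ k ^ 2))) (F k / 2)
    refine ⟨C, fun d Y ℓ φ x y T hT hadm => ?_⟩
    have h1 := BayesEnsemble.sum_mixLoss_bmaWeights_le hw₀
      (fun t ht => hadm.expertDensities_pos ht) hk
    have h2 := hadm.sum_neg_log_expertDensities_sub_le hσ (by omega) k θ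
    have h3 := hC T hT
    unfold BayesEnsemble.regret
    linarith
  · obtain ⟨hβ2, hβB⟩ := BayesEnsemble.newtonStepSize_bounds k.pos hβ hβle
    obtain ⟨C, hC⟩ := BayesEnsemble.exists_add_mul_log_le
      (β / 2 * (ε * ((w₁ - Pi.single k 1) ⬝ᵥ (w₁ - Pi.single k 1))) +
        (2 * β)⁻¹ * (K * Real.log (K * ε + K * Real.exp (4 * B)) - K * Real.log ε) +
        (‖θ‖ ^ 2 / (2 * σ k ^ 2) + F k / 2 * Real.log (1 + max c 0 * σ k ^ 2)))
      ((2 * β)⁻¹ * K + F k / 2)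
    refine ⟨C, fun d Y ℓ φ x y T hT hadm hB => ?_⟩
    -- Positivity is needed to turn the bound on `|log r|` into `exp (-B) ≤ r ≤ exp B`, as
    -- `Real.log` ignores sign.
    have hpos := fun t ht j => hadm.expertDensities_pos (t := t) ht j
    have h1 := BayesEnsemble.sum_mixLoss_onsWeights_le hw₁ hε hβ hβ2 hβB
      (fun t ht j => (Real.le_log_iff_exp_le (hpos t ht j)).1 (abs_le.1 (hB t ht j)).1)
      (fun t ht j => (Real.log_le_iff_le_exp (hpos t ht j)).1 (abs_le.1 (hB t ht j)).2)
      (by omega) k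
    have h2 := hadm.sum_neg_log_expertDensities_sub_le hσ (by omega) k θ
    have h3 := hC T hT
    unfold BayesEnsemble.regret
    linarith
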